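/- Let $n,d$ be integers with $n\ge 1$, let $e_1,\dots,e_n\subseteq\{1,\dots,d\}$, and let $F(x)=\frac1n\sum_{i=1}^n f_i(x_{e_i})$ for $x\in\mathbb{R}^d$, where $x_{e_i}$ is the vector of the entries of $x$ indexed by $e_i$ and $g_i(x):=f_i(x_{e_i})$ denotes the $i$-th component as a function on $\mathbb{R}^d$. Let $$\rho=\frac1n\max_{1\le i\le n}\bigl|\{j\in\{1,\dots,n\}: e_i\cap e_j\neq\emptyset\}\bigr|$$ be the sparsity factor. Let $\mu>0$, $L,L_H,D,G$ be constants and assume: - each $g_i$ is convex and twice differentiable, with $\|\nabla g_i(x)-\nabla g_i(y)\|\le L\|x-y\|$ and $\|\nabla^2 g_i(x)-\nabla^2 g_i(y)\|\le L_H\|x-y\|$ for all $x,y\in\mathbb{R}^d$ (Euclidean norm, spectral norm); - $F(x)\ge F(y)+\langle\nabla F(y),x-y\rangle+\frac{\mu}{2}\|x-y\|^2$ for all $x,y\in\mathbb{R}^d$, and $x^*$ is the minimizer of $F$; - $\|\nabla g_i(x)\|\le G$ for every $i$ and every $x$ with $\|x-x^*\|\le D$. RandomShuffle with step size $\eta$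 and initial point $x_0$ draws, for epochs $t=1,\dots,l$, independent uniformly random permutations $\sigma_t$ of $\{1,\dots,n\}$, and sets $x^1_0=x_0$, $x^t_k=x^t_{k-1}-\eta\nabla g_{\sigma_t(k)}(x^t_{k-1})$ for $1\le k\le n$, and $x^{t+1}_0=x^t_n$. Let $T=ln$ with $l\ge1$, and $x_T=x^l_n$. Let $$C=\max\Bigl\{\tfrac{32}{\mu^2}(L_HLD+3L_HG),\;12\bigl(1+\tfrac L\mu\bigr)\Bigr\},$$ and assume that $T>1$, $\frac{T}{\log T}>Cn$, that $\eta=\frac{8\log T}{T\mu}$, and that almost surely all iterates $x^t_k$ ($1\le t\le l$, $0\le k\le n$) satisfy $\|x^t_k-x^*\|\le D$. Then $$\mathbb{E}\|x_T-x^*\|^2\le K(\log T)^p\Bigl(\frac1{T^2}+\frac{\rho^2n^3}{T^3}\Bigr),$$ where $p$ is an absolute constant and $K$ depends only on $\mu,L,L_H,D,G$. In particular, for every constant $c$: if moreover $\rho\le c/n$, then $\mathbb{E}\|x_T-x^*\|^2\le K'(\log T)^p\frac1{T^2}$, where $K'$ depends only on $c,\mu,L,L_H,D,G$. -/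

import Mathlib

universe u

namespace RandomShuffle

noncomputable section

/-- The subvector `x_s` of the entries of `x ∈ ℝ^d` indexed by `s`. -/
def subvector {d : ℕ} (s : Finset (Fin d)) (x : EuclideanSpace ℝ (Fin d)) :
    EuclideanSpace ℝ s :=
  WithLp.toLp 2 (fun j : s => x j.1)

/-- The `i`-th component `x ↦ f_i(x_{e_i})`, as a function on `ℝ^d`. -/
def component {d n : ℕ} (e : Fin n → Finset (Fin d))
    (f : (i : Fin n) → EuclideanSpace ℝ (e i) → ℝ) (i : Fin n)
    (x : EuclideanSpace ℝ (Fin d)) : ℝ :=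
  f i (subvector (e i) x)

/-- The sparse finite sum `F(x) = (1/n) ∑ᵢ f_i(x_{e_i})`. -/
def objective {d n : ℕ} (e : Fin n → Finset (Fin d))
    (f : (i : Fin n) → EuclideanSpace ℝ (e i) → ℝ) (x : EuclideanSpace ℝ (Fin d)) : ℝ :=
  (1 / (n : ℝ)) * ∑ i, component e f i x

/-- The sparsity factor `ρ = maxᵢ #{j : e_i ∩ e_j ≠ ∅} / n`. The supports are counted with their
indices (they are the `n` nodes of the intersection graph), so repeated supports count
repeatedly. -/
def sparsityFactor {d n : ℕ} (e : Fin n → Finset (Fin d)) : ℝ :=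
  ((Finset.univ.sup fun i : Fin n =>
    (Finset.univ.filter fun j : Fin n => (e i ∩ e j).Nonempty).card : ℕ) : ℝ) / (n : ℝ)

/-- The Hessian of `g` at `x`, as a continuous linear map; its norm is the spectral norm. -/
def hessian {d : ℕ} (g : EuclideanSpace ℝ (Fin d) → ℝ) (x : EuclideanSpace ℝ (Fin d)) :
    EuclideanSpace ℝ (Fin d) →L[ℝ] EuclideanSpace ℝ (Fin d) :=
  fderiv ℝ (gradient g) x

/-- The `k`-th iterate of one epoch with step size `γ` and permutation `π`, started at `x`:
`x_{k+1} = x_k - γ ∇g_{π(k)}(x_k)`, for `0 ≤ k < n` (and constant after the epoch has ended). -/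
def epochIterate {d n : ℕ} (g : Fin n → EuclideanSpace ℝ (Fin d) → ℝ) (γ : ℝ)
    (π : Equiv.Perm (Fin n)) (x : EuclideanSpace ℝ (Fin d)) : ℕ → EuclideanSpace ℝ (Fin d)
  | 0 => x
  | k + 1 =>
    if h : k < n then
      epochIterate g γ π x k - γ • gradient (g (π ⟨k, h⟩)) (epochIterate g γ π x k)
    else epochIterate g γ π x k

/-- The point reached after `t` full epochs, epoch number `t` (counted from `0`) using the
permutation `σ t`. After `l` epochs this is the iterate `x_T` with `T = l n`. -/
def epochStart {d n : ℕ} (g : Fin n → EuclideanSpace ℝ (Fin d) → ℝ) (γ : ℝ)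
    (σ : ℕ → Equiv.Perm (Fin n)) (x₀ : EuclideanSpace ℝ (Fin d)) : ℕ → EuclideanSpace ℝ (Fin d)
  | 0 => x₀
  | t + 1 => epochIterate g γ (σ t) (epochStart g γ σ x₀ t) n

/-- The step size `8 log T / (T μ)`. -/
def stepSize (μ : ℝ) (T : ℕ) : ℝ := 8 * Real.log T / (T * μ)

/-- The constant `max {(32/μ²)(L_H L D + 3 L_H G), 12 (1 + L/μ)}`. -/
def threshold (μ L LH D G : ℝ) : ℝ :=
  max (32 / μ ^ 2 * (LH * L * D + 3 * LH * G)) (12 * (1 + L / μ))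

/-- Assumptions on the sparse finite sum with minimizer `xstar`. -/
structure IsAdmissibleProblem {d n : ℕ} (e : Fin n → Finset (Fin d))
    (f : (i : Fin n) → EuclideanSpace ℝ (e i) → ℝ) (xstar : EuclideanSpace ℝ (Fin d))
    (μ L LH D G : ℝ) : Prop where
  convex : ∀ i, ConvexOn ℝ Set.univ (component e f i)
  differentiable : ∀ i, Differentiable ℝ (component e f i)
  differentiable_gradient : ∀ i, Differentiable ℝ (gradient (component e f i))
  strong_convexity : ∀ x y, objective e f y + inner ℝ (gradient (objective e f) y) (x - y)
    + μ / 2 * ‖x - y‖ ^ 2 ≤ objective e f x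
  smooth : ∀ i x y,
    ‖gradient (component e f i) x - gradient (component e f i) y‖ ≤ L * ‖x - y‖
  hessian_lipschitz : ∀ i x y,
    ‖hessian (component e f i) x - hessian (component e f i) y‖ ≤ LH * ‖x - y‖
  minimizer : ∀ x, objective e f xstar ≤ objective e f x
  gradient_bound : ∀ i x, ‖x - xstar‖ ≤ D → ‖gradient (component e f i) x‖ ≤ G

/-- `σ 0, σ 1, …` are independent random permutations, each uniformly distributed on the
set of all `n!` permutations. -/
structure IsUniformShuffling {n : ℕ} {Ω : Type u} [MeasurableSpace Ω]
    (P : MeasureTheory.Measure Ω) (σ : ℕ → Ω → Equiv.Perm (Fin n)) : Prop where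
  measurable : ∀ t π, MeasurableSet {ω | σ t ω = π}
  uniform : ∀ t π, P.real {ω | σ t ω = π} = 1 / (n.factorial : ℝ)
  indep : ProbabilityTheory.iIndepFun (m := fun _ => (⊤ : MeasurableSpace (Equiv.Perm (Fin n)))) σ P

/-- A run of `l` epochs of the algorithm on an admissible problem: `T = l n`, the step size is
`8 log T / (T μ)`, the condition `T / log T > C n` holds, and all iterates of the run stay
within distance `D` of the minimizer. -/
structure IsAdmissibleRun {d n : ℕ} {Ω : Type u} [MeasurableSpace Ω]
    (P : MeasureTheory.Measure Ω) (e : Fin n → Finset (Fin d))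
    (f : (i : Fin n) → EuclideanSpace ℝ (e i) → ℝ) (xstar x₀ : EuclideanSpace ℝ (Fin d))
    (σ : ℕ → Ω → Equiv.Perm (Fin n)) (l : ℕ) (μ L LH D G : ℝ) : Prop where
  n_pos : 0 < n
  l_pos : 0 < l
  problem : IsAdmissibleProblem e f xstar μ L LH D G
  shuffling : IsUniformShuffling P σ
  enough_epochs : ((l * n : ℕ) : ℝ) / Real.log ((l * n : ℕ) : ℝ) > threshold μ L LH D G * n
  bounded_iterates : ∀ᵐ ω ∂P, ∀ t < l, ∀ k ≤ n,
    ‖epochIterate (component e f) (stepSize μ (l * n)) (σ t ω)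
      (epochStart (component e f) (stepSize μ (l * n)) (fun s => σ s ω) x₀ t) k - xstar‖ ≤ D

/-- `E ‖x_T - x*‖²` for the run of `l` epochs, `T = l n`, with step size `8 log T / (T μ)`. -/
def expectedError {d n : ℕ} {Ω : Type u} [MeasurableSpace Ω]
    (P : MeasureTheory.Measure Ω) (e : Fin n → Finset (Fin d))
    (f : (i : Fin n) → EuclideanSpace ℝ (e i) → ℝ) (xstar x₀ : EuclideanSpace ℝ (Fin d))
    (σ : ℕ → Ω → Equiv.Perm (Fin n)) (l : ℕ) (μ : ℝ) : ℝ :=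
  ∫ ω, ‖epochStart (component e f) (stepSize μ (l * n)) (fun s => σ s ω) x₀ l - xstar‖ ^ 2 ∂P

end

end RandomShuffle

/-! Write a = x - x*, U = ∑ ∇g_i(x) = n∇F(x), H_i for the Hessian of g_i at x, and m = ρn. An epoch
from x ends at x - γ(U + R), where R sums the changes of the component gradients along the way. At
most m supports meet a given one, so each gradient changes by O(γm) instead of O(γn), and R = -γS +
O(γ²m²n), where S sums H_k ∇g_j(x) over the pairs with j before k (`norm_gradient_sub_le`,
`norm_gradient_sub_add_le`).

Pairing an order with its reversal shows that S has mean ½(∑ H_i U - ∑ H_i ∇g_i(x))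
(`sum_crossTerm`). Since the Hessians are symmetric and ∇F(x*) = 0, ⟨a, ∑ H_i U⟩ is nearly ‖U‖²
(`inner_hessian_sum_le`), which -2γ⟨a, U⟩ absorbs by co-coercivity. The diagonal part costs γ²n‖a‖,
that is γ³n after Young's inequality. On average an epoch multiplies ‖a‖² by 1 - γnμ/4 and adds
O(γ³n + γ⁴n²m²) (`sum_perm_sq_norm_le`).

Over l epochs the accumulated noise is at most the noise of one epoch divided by γnμ/4, hence O(γ² +
γ³nm²): this is log²T/T² + ρ²n³log³T/T³. The initial error shrinks by exp(-2 log T) = T⁻². -/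

namespace RandomShuffle

/-! ### Taylor bounds, symmetric Hessians and co-coercivity -/

section Calculus

variable {E : Type*} [NormedAddCommGroup E] [InnerProductSpace ℝ E]

/-- First order Taylor estimate for a map with Lipschitz derivative. -/
theorem norm_sub_sub_fderiv_le {h : E → E} (hh : Differentiable ℝ h) {M : ℝ} (hM : 0 ≤ M)
    (hlip : ∀ x y, ‖fderiv ℝ h x - fderiv ℝ h y‖ ≤ M * ‖x - y‖) (x v : E) :
    ‖h (x + v) - h x - fderiv ℝ h x v‖ ≤ M * ‖v‖ ^ 2 := by
  have := (convex_closedBall x ‖v‖).norm_image_sub_le_of_norm_fderiv_le' (𝕜 := ℝ) (f := h)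
    (φ := fderiv ℝ h x) (C := M * ‖v‖) (x := x) (y := x + v) (fun y _ => hh y)
    (fun y hy => (hlip y x).trans (by
      rw [mem_closedBall_iff_norm] at hy
      gcongr)) (by simp) (by simp)
  simpa [sq, mul_assoc] using this

theorem fderiv_apply_eq_zero_of_invariant {G : Type*} [NormedAddCommGroup G] [NormedSpace ℝ G]
    {h : E → G} (hh : Differentiable ℝ h) {v : E} (hv : ∀ x, ∀ t : ℝ, h (x + t • v) = h x) (x : E) :
    fderiv ℝ h x v = 0 := by
  have h1 : HasDerivAt (fun t : ℝ => x + t • v) v 0 := by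
    simpa using ((hasDerivAt_id (0 : ℝ)).smul_const v).const_add x
  have h2 := (hh (x + (0 : ℝ) • v)).hasFDerivAt.comp_hasDerivAt 0 h1
  have h3 : (h ∘ fun t : ℝ => x + t • v) = fun _ => h x := funext fun t => hv x t
  rw [h3] at h2
  simpa using h2.unique (hasDerivAt_const 0 (h x))

variable [CompleteSpace E]

/-- The Hessian of a twice differentiable function is symmetric. -/
theorem inner_fderiv_gradient_comm {g : E → ℝ} (hg : Differentiable ℝ g)
    (hg' : Differentiable ℝ (gradient g)) (x v w : E) :
    inner ℝ (fderiv ℝ (gradient g) x v) w = inner ℝ v (fderiv ℝ (gradient g) x w) := by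
  have h1 : ∀ y, HasFDerivAt g (fderiv ℝ g y) y := fun y => (hg y).hasFDerivAt
  -- Composing with the Riesz map `B` turns the derivative of the gradient into a second derivative
  -- of `g`, whose symmetry needs no continuity.
  let B : E →L[ℝ] E →L[ℝ] ℝ := (isBoundedBilinearMap_inner (𝕜 := ℝ) (E := E)).toContinuousLinearMap
  have hB : ∀ u z, B u z = inner ℝ u z := fun _ _ => rfl
  have h2 : HasFDerivAt (fderiv ℝ g) (B.comp (fderiv ℝ (gradient g) x)) x := by
    have e : fderiv ℝ g = B ∘ gradient g := by
      ext y z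
      rw [Function.comp_apply, hB, inner_gradient_left]
    rw [e]
    exact B.hasFDerivAt.comp x (hg' x).hasFDerivAt
  have := second_derivative_symmetric h1 h2 v w
  rw [real_inner_comm _ v]
  simpa [hB] using this

/-- Quadratic upper bound for a function with Lipschitz gradient. -/
theorem le_add_inner_gradient_add_sq {F : E → ℝ} (hF : Differentiable ℝ F) {L : ℝ}
    (hlip : ∀ x y, ‖gradient F x - gradient F y‖ ≤ L * ‖x - y‖) (x v : E) :
    F (x + v) ≤ F x + inner ℝ (gradient F x) v + L / 2 * ‖v‖ ^ 2 := by
  -- The defect along the segment is nonincreasing on [0, 1]; comparing its endpoints gives the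
  -- claim.
  have hd : ∀ t : ℝ, HasDerivAt
      (fun t : ℝ => F (x + t • v) - t * inner ℝ (gradient F x) v - L / 2 * ‖v‖ ^ 2 * t ^ 2)
      (inner ℝ (gradient F (x + t • v)) v - inner ℝ (gradient F x) v - L * ‖v‖ ^ 2 * t) t := by
    intro t
    have h1 : HasDerivAt (fun t : ℝ => x + t • v) v t := by
      simpa using ((hasDerivAt_id t).smul_const v).const_add x
    have h2 := (hF (x + t • v)).hasFDerivAt.comp_hasDerivAt t h1
    rw [← inner_gradient_left] at h2
    have h3 := (hasDerivAt_id' t).mul_const (inner ℝ (gradient F x) v)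
    have h4 := (hasDerivAt_pow 2 t).const_mul (L / 2 * ‖v‖ ^ 2)
    refine HasDerivAt.congr_deriv ((h2.sub h3).sub h4) ?_
    norm_num
    ring
  have hanti : AntitoneOn
      (fun t : ℝ => F (x + t • v) - t * inner ℝ (gradient F x) v - L / 2 * ‖v‖ ^ 2 * t ^ 2)
      (Set.Icc 0 1) := by
    refine antitoneOn_of_deriv_nonpos (convex_Icc 0 1)
      (fun t _ => (hd t).continuousAt.continuousWithinAt)
      (fun t _ => (hd t).differentiableAt.differentiableWithinAt) (fun t ht => ?_)
    rw [interior_Icc] at ht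
    rw [(hd t).deriv, ← inner_sub_left]
    have h1 := real_inner_le_norm (gradient F (x + t • v) - gradient F x) v
    have h2 := hlip (x + t • v) x
    rw [add_sub_cancel_left, norm_smul, Real.norm_of_nonneg ht.1.le] at h2
    nlinarith [mul_le_mul_of_nonneg_right h2 (norm_nonneg v)]
  have := hanti (by simp) (by simp) (zero_le_one' ℝ)
  simp only [one_smul, one_mul, zero_smul, add_zero, zero_mul, one_pow, mul_one] at this
  linarith

/-- Co-coercivity, at the minimizer, of the gradient of a convex function. -/
theorem sq_norm_gradient_le {F : E → ℝ} (hF : Differentiable ℝ F) {L : ℝ} (hL : 0 < L)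
    (hlip : ∀ x y, ‖gradient F x - gradient F y‖ ≤ L * ‖x - y‖)
    (hconv : ∀ x y, F y + inner ℝ (gradient F y) (x - y) ≤ F x)
    {z : E} (hz : gradient F z = 0) (x : E) :
    ‖gradient F x‖ ^ 2 ≤ L * inner ℝ (gradient F x) (x - z) := by
  -- Comparison at z + ∇F(x)/L (`h1`, `h2`) and at x - ∇F(x)/L (`h3`, `h4`): each pair contributes
  -- ‖∇F(x)‖²/(2L).
  have h1 := le_add_inner_gradient_add_sq hF hlip z (L⁻¹ • gradient F x)
  have h2 := hconv (z + L⁻¹ • gradient F x) x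
  have h3 := le_add_inner_gradient_add_sq hF hlip x (-(L⁻¹ • gradient F x))
  have h4 := hconv (x + -(L⁻¹ • gradient F x)) z
  have e : z + L⁻¹ • gradient F x - x = L⁻¹ • gradient F x - (x - z) := by abel
  rw [e, inner_sub_right, real_inner_smul_right, real_inner_self_eq_norm_sq] at h2
  rw [hz, inner_zero_left, norm_smul, Real.norm_of_nonneg (inv_nonneg.2 hL.le)] at h1
  rw [norm_neg, inner_neg_right, real_inner_smul_right, real_inner_self_eq_norm_sq, norm_smul,
    Real.norm_of_nonneg (inv_nonneg.2 hL.le)] at h3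
  rw [hz, inner_zero_left] at h4
  have e2 : L / 2 * (L⁻¹ * ‖gradient F x‖) ^ 2 = L⁻¹ * ‖gradient F x‖ ^ 2 / 2 := by
    field_simp
  rw [e2] at h1 h3
  have h5 : L⁻¹ * ‖gradient F x‖ ^ 2 ≤ inner ℝ (gradient F x) (x - z) := by linarith
  calc ‖gradient F x‖ ^ 2 = L * (L⁻¹ * ‖gradient F x‖ ^ 2) := by field_simp
    _ ≤ _ := by gcongr

/-- A strongly convex function has a strongly monotone gradient. -/
theorem mul_sq_norm_le_inner_gradient {F : E → ℝ} {μ : ℝ}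
    (hconv : ∀ x y, F y + inner ℝ (gradient F y) (x - y) + μ / 2 * ‖x - y‖ ^ 2 ≤ F x)
    {z : E} (hz : gradient F z = 0) (x : E) :
    μ * ‖x - z‖ ^ 2 ≤ inner ℝ (gradient F x) (x - z) := by
  have h1 := hconv x z
  have h2 := hconv z x
  rw [hz, inner_zero_left] at h1
  rw [← neg_sub x z, inner_neg_right, norm_neg] at h2
  linarith

theorem gradient_add_right_of_invariant {g : E → ℝ} {v : E} (hv : ∀ x, g (x + v) = g x) (x : E) :
    gradient g (x + v) = gradient g x := by
  have : (fun y => g (y + v)) = g := funext hv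
  rw [gradient, gradient, ← fderiv_comp_add_right, this]

end Calculus

/-! ### Supports of components and degrees in the intersection graph -/

section Sparsity

variable {d n : ℕ} {e : Fin n → Finset (Fin d)} {f : (i : Fin n) → EuclideanSpace ℝ (e i) → ℝ}

/-- A component does not see the coordinates outside its support. -/
theorem component_add_of_vanish {i : Fin n} {v : EuclideanSpace ℝ (Fin d)}
    (hv : ∀ m ∈ e i, v m = 0) (x : EuclideanSpace ℝ (Fin d)) :
    component e f i (x + v) = component e f i x := by
  have : subvector (e i) (x + v) = subvector (e i) x := by
    ext j
    simp [subvector, hv j.1 j.2]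
  simp [component, this]

theorem gradient_component_add_of_vanish {i : Fin n} {v : EuclideanSpace ℝ (Fin d)}
    (hv : ∀ m ∈ e i, v m = 0) (x : EuclideanSpace ℝ (Fin d)) :
    gradient (component e f i) (x + v) = gradient (component e f i) x :=
  gradient_add_right_of_invariant (component_add_of_vanish hv) x

theorem hessian_component_apply_of_vanish {i : Fin n}
    (hd : Differentiable ℝ (gradient (component e f i))) {v : EuclideanSpace ℝ (Fin d)}
    (hv : ∀ m ∈ e i, v m = 0) (x : EuclideanSpace ℝ (Fin d)) :
    hessian (component e f i) x v = 0 :=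
  fderiv_apply_eq_zero_of_invariant hd
    (fun x t => gradient_component_add_of_vanish (fun m hm => by simp [hv m hm]) x) x

/-- The gradient of a component is supported on the support of the component. -/
theorem gradient_component_apply_of_notMem {i : Fin n}
    (hd : Differentiable ℝ (component e f i)) (x : EuclideanSpace ℝ (Fin d)) {m : Fin d}
    (hm : m ∉ e i) : gradient (component e f i) x m = 0 := by
  have h : fderiv ℝ (component e f i) x (EuclideanSpace.single m 1) = 0 := by
    refine fderiv_apply_eq_zero_of_invariant hd (fun x t => component_add_of_vanish ?_ x) x
    intro m' hm'
    have : m' ≠ m := fun h => hm (h ▸ hm')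
    simp [this]
  rw [← inner_gradient_left] at h
  rwa [EuclideanSpace.inner_single_right, one_mul] at h

/-- The maximal number of components that meet a given one. -/
def maxDegree (e : Fin n → Finset (Fin d)) : ℕ :=
  Finset.univ.sup fun i : Fin n =>
    (Finset.univ.filter fun j : Fin n => (e i ∩ e j).Nonempty).card

theorem card_neighbors_le (π : Equiv.Perm (Fin n)) (i : Fin n) :
    (Finset.univ.filter fun j : Fin n => (e i ∩ e (π j)).Nonempty).card ≤ maxDegree e := by
  have h1 : (Finset.univ.filter fun j : Fin n => (e i ∩ e (π j)).Nonempty).card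
      = (Finset.univ.filter fun j : Fin n => (e i ∩ e j).Nonempty).card := by
    refine Finset.card_equiv π fun j => by simp
  rw [h1]
  exact Finset.le_sup (f := fun i : Fin n =>
    (Finset.univ.filter fun j : Fin n => (e i ∩ e j).Nonempty).card) (Finset.mem_univ i)

theorem maxDegree_le : maxDegree e ≤ n :=
  Finset.sup_le fun i _ => (Finset.card_filter_le _ _).trans (by simp)

theorem sparsityFactor_mul_eq (hn : 0 < n) : sparsityFactor e * n = maxDegree e := by
  have : (n : ℝ) ≠ 0 := by positivity
  rw [sparsityFactor, div_mul_cancel₀ _ this, maxDegree]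

end Sparsity

/-! ### Expansion of one epoch, and the average over orders -/

section Epoch

variable {d n : ℕ} {e : Fin n → Finset (Fin d)} {f : (i : Fin n) → EuclideanSpace ℝ (e i) → ℝ}
  {xstar : EuclideanSpace ℝ (Fin d)} {μ L LH D G : ℝ}

theorem epochIterate_eq_sub_sum (g : Fin n → EuclideanSpace ℝ (Fin d) → ℝ) (γ : ℝ)
    (π : Equiv.Perm (Fin n)) (x : EuclideanSpace ℝ (Fin d)) {k : ℕ} (hk : k ≤ n) :
    epochIterate g γ π x k = x - γ • ∑ j : Fin n with j.1 < k,
      gradient (g (π j)) (epochIterate g γ π x j) := by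
  induction k with
  | zero => simp [epochIterate]
  | succ k ih =>
    have hkn : k < n := hk
    have hs : (Finset.univ.filter fun j : Fin n => j.1 < k + 1)
        = insert ⟨k, hkn⟩ (Finset.univ.filter fun j : Fin n => j.1 < k) := by
      ext j
      simp [Fin.ext_iff]
      omega
    rw [hs, Finset.sum_insert (by simp), smul_add, epochIterate, dif_pos hkn,
      add_comm, ← sub_sub, ← ih hkn.le]

/-- On the support of one component, a sum of vectors supported on the supports of the components
agrees with a sum of at most `maxDegree e` of them. -/
theorem exists_eq_on_support_norm_le (π : Equiv.Perm (Fin n)) {w : Fin n → EuclideanSpace ℝ (Fin d)}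
    {B : ℝ} (hw : ∀ j, ∀ m ∉ e (π j), w j m = 0) (hB : ∀ j, ‖w j‖ ≤ B) (hB0 : 0 ≤ B) (i : Fin n)
    (s : Finset (Fin n)) :
    ∃ v, (∀ m ∈ e i, (∑ j ∈ s, w j - v) m = 0) ∧ ‖v‖ ≤ maxDegree e * B := by
  -- Only the neighbours of `i` are kept; every other summand vanishes on `e i`.
  refine ⟨∑ j ∈ s with (e i ∩ e (π j)).Nonempty, w j, fun m hm => ?_, ?_⟩
  · rw [← Finset.sum_filter_add_sum_filter_not s (fun j => (e i ∩ e (π j)).Nonempty),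
      add_sub_cancel_left, WithLp.ofLp_sum, Finset.sum_apply]
    refine Finset.sum_eq_zero fun j hj => hw j m fun hmj => ?_
    exact (Finset.mem_filter.1 hj).2 ⟨m, Finset.mem_inter.2 ⟨hm, hmj⟩⟩
  · calc ‖∑ j ∈ s with (e i ∩ e (π j)).Nonempty, w j‖
        ≤ (s.filter fun j => (e i ∩ e (π j)).Nonempty).card • B :=
          (norm_sum_le_of_le _ fun j _ => hB j).trans (by simp)
      _ ≤ maxDegree e * B := by
          rw [nsmul_eq_mul]
          gcongr
          refine le_trans (Finset.card_le_card ?_) (card_neighbors_le (e := e) π i)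
          exact Finset.filter_subset_filter _ (Finset.subset_univ s)

theorem IsAdmissibleProblem.norm_hessian_le (hP : IsAdmissibleProblem e f xstar μ L LH D G)
    (hL : 0 ≤ L) (i : Fin n) (x : EuclideanSpace ℝ (Fin d)) :
    ‖hessian (component e f i) x‖ ≤ L :=
  norm_fderiv_le_of_lip' ℝ hL (Filter.Eventually.of_forall fun y => hP.smooth i y x)

/-- Displacement of the gradient of a component during an epoch. -/
theorem IsAdmissibleProblem.norm_gradient_sub_le (hP : IsAdmissibleProblem e f xstar μ L LH D G)
    (hL : 0 ≤ L) (hG : 0 ≤ G) {γ : ℝ} (hγ : 0 ≤ γ) (π : Equiv.Perm (Fin n))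
    (x : EuclideanSpace ℝ (Fin d))
    (hx : ∀ k ≤ n, ‖epochIterate (component e f) γ π x k - xstar‖ ≤ D) (k : Fin n) :
    ‖gradient (component e f (π k)) (epochIterate (component e f) γ π x k)
      - gradient (component e f (π k)) x‖ ≤ L * (γ * (maxDegree e * G)) := by
  obtain ⟨v, hv, hvn⟩ := exists_eq_on_support_norm_le (e := e) π
    (w := fun j => gradient (component e f (π j)) (epochIterate (component e f) γ π x j)) (B := G)
    (fun j m hm => gradient_component_apply_of_notMem (hP.differentiable _) _ hm)
    (fun j => hP.gradient_bound _ _ (hx j j.2.le)) hG (π k)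
    (Finset.univ.filter fun j : Fin n => j.1 < k.1)
  -- The last summand vanishes on the support of the current component, so its gradient sees only
  -- the displacement `-γ • v`.
  have hy : epochIterate (component e f) γ π x k = (x - γ • v) + (-γ) • (∑ j : Fin n with j.1 < k.1,
      gradient (component e f (π j)) (epochIterate (component e f) γ π x j) - v) := by
    rw [epochIterate_eq_sub_sum _ _ _ _ k.2.le]
    module
  rw [hy, gradient_component_add_of_vanish (fun m hm => by
    rw [PiLp.smul_apply, hv m hm, smul_zero])]
  refine (hP.smooth _ _ _).trans ?_
  rw [sub_sub_cancel_left, norm_neg, norm_smul, Real.norm_of_nonneg hγ]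
  gcongr

/-- Second order expansion of the gradient of a component during an epoch. -/
theorem IsAdmissibleProblem.norm_gradient_sub_add_le
    (hP : IsAdmissibleProblem e f xstar μ L LH D G)
    (hL : 0 ≤ L) (hLH : 0 ≤ LH) (hG : 0 ≤ G) {γ : ℝ} (hγ : 0 ≤ γ) (π : Equiv.Perm (Fin n))
    (x : EuclideanSpace ℝ (Fin d))
    (hx : ∀ k ≤ n, ‖epochIterate (component e f) γ π x k - xstar‖ ≤ D) (k : Fin n) :
    ‖gradient (component e f (π k)) (epochIterate (component e f) γ π x k)
      - gradient (component e f (π k)) x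
      + γ • hessian (component e f (π k)) x
        (∑ j : Fin n with j.1 < k.1, gradient (component e f (π j)) x)‖
      ≤ γ ^ 2 * (maxDegree e : ℝ) ^ 2 * (LH * G ^ 2 + L ^ 2 * G) := by
  set y : ℕ → EuclideanSpace ℝ (Fin d) := epochIterate (component e f) γ π x with hydef
  set h : Fin n → EuclideanSpace ℝ (Fin d) → EuclideanSpace ℝ (Fin d) :=
    fun i => gradient (component e f i) with hh
  set s := Finset.univ.filter fun j : Fin n => j.1 < k.1
  set H := hessian (component e f (π k)) x with hH
  have hHz : ∀ v : EuclideanSpace ℝ (Fin d), (∀ m ∈ e (π k), v m = 0) → H v = 0 := fun v hv =>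
    hessian_component_apply_of_vanish (hP.differentiable_gradient _) hv x
  obtain ⟨v, hv, hvn⟩ := exists_eq_on_support_norm_le (e := e) π
    (w := fun j => h (π j) (y j)) (B := G)
    (fun j m hm => gradient_component_apply_of_notMem (hP.differentiable _) _ hm)
    (fun j => hP.gradient_bound _ _ (hx j j.2.le)) hG (π k) s
  -- Truncation is used again, now for the gradient changes themselves: this yields the factor m² in
  -- place of nm.
  obtain ⟨v', hv', hvn'⟩ := exists_eq_on_support_norm_le (e := e) π
    (w := fun j => h (π j) (y j) - h (π j) x) (B := L * (γ * (maxDegree e * G)))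
    (fun j m hm => by
      simp only [hh, PiLp.sub_apply,
        gradient_component_apply_of_notMem (hP.differentiable _) _ hm, sub_zero])
    (fun j => hP.norm_gradient_sub_le hL hG hγ π x hx j) (by positivity) (π k) s
  have hy : y k = (x + -(γ • v)) + (-γ) • (∑ j ∈ s, h (π j) (y j) - v) := by
    rw [hydef, epochIterate_eq_sub_sum _ _ _ _ k.2.le]
    module
  have hg : h (π k) (y k) = h (π k) (x + -(γ • v)) := by
    rw [hy]
    exact gradient_component_add_of_vanish (fun m hm => by
      rw [PiLp.smul_apply, hv m hm, smul_zero]) _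
  have hH1 : H v = H (∑ j ∈ s, h (π j) (y j)) := by
    have := hHz _ hv
    rw [map_sub, sub_eq_zero] at this
    exact this.symm
  have hH2 : H v' = H (∑ j ∈ s, h (π j) (y j)) - H (∑ j ∈ s, h (π j) x) := by
    have := hHz _ hv'
    rw [map_sub, sub_eq_zero, Finset.sum_sub_distrib, map_sub] at this
    exact this.symm
  -- A Taylor remainder at the truncated displacement, plus the error of freezing the earlier
  -- gradients at `x`. The Hessian does not distinguish a sum from its truncation.
  have key : h (π k) (y k) - h (π k) x + γ • H (∑ j ∈ s, h (π j) x)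
      = (h (π k) (x + -(γ • v)) - h (π k) x - H (-(γ • v))) - γ • H v' := by
    rw [hg, map_neg, map_smul, hH1, hH2]
    module
  have hnorm : ‖-(γ • v)‖ ≤ γ * (maxDegree e * G) := by
    rw [norm_neg, norm_smul, Real.norm_of_nonneg hγ]
    gcongr
  have b1 : ‖h (π k) (x + -(γ • v)) - h (π k) x - H (-(γ • v))‖
      ≤ LH * (γ * (maxDegree e * G)) ^ 2 :=
    (norm_sub_sub_fderiv_le (hP.differentiable_gradient (π k)) hLH
      (hP.hessian_lipschitz (π k)) x _).trans (by gcongr)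
  have b2 : ‖γ • H v'‖ ≤ γ * (L * (maxDegree e * (L * (γ * (maxDegree e * G))))) := by
    rw [norm_smul, Real.norm_of_nonneg hγ]
    gcongr
    exact H.le_of_opNorm_le_of_le (hP.norm_hessian_le hL _ _) hvn'
  change ‖h (π k) (y k) - h (π k) x + γ • H (∑ j ∈ s, h (π j) x)‖ ≤ _
  rw [key]
  calc _ ≤ LH * (γ * (maxDegree e * G)) ^ 2
        + γ * (L * (maxDegree e * (L * (γ * (maxDegree e * G))))) :=
        (norm_sub_le _ _).trans (add_le_add b1 b2)
    _ = _ := by ring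

/-- The first order part of the drift of an epoch. -/
noncomputable def crossTerm (e : Fin n → Finset (Fin d))
    (f : (i : Fin n) → EuclideanSpace ℝ (e i) → ℝ) (x : EuclideanSpace ℝ (Fin d))
    (π : Equiv.Perm (Fin n)) : EuclideanSpace ℝ (Fin d) :=
  ∑ k, hessian (component e f (π k)) x
    (∑ j : Fin n with j.1 < k.1, gradient (component e f (π j)) x)

/-- Adding the cross terms of an order and of its reversal removes the dependence on the order. -/
theorem crossTerm_add_crossTerm_rev (x : EuclideanSpace ℝ (Fin d)) (π : Equiv.Perm (Fin n)) :
    crossTerm e f x π + crossTerm e f x (π * Fin.revPerm)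
      = ∑ i, hessian (component e f i) x (∑ j, gradient (component e f j) x)
        - ∑ i, hessian (component e f i) x (gradient (component e f i) x) := by
  -- Reversal exchanges "before" and "after", so the two cross terms together contain every ordered
  -- pair once, except the diagonal.
  have h1 : crossTerm e f x (π * Fin.revPerm) = ∑ k, hessian (component e f (π k)) x
      (∑ j : Fin n with k.1 < j.1, gradient (component e f (π j)) x) := by
    rw [crossTerm, ← Equiv.sum_comp Fin.revPerm]
    refine Finset.sum_congr rfl fun k _ => ?_
    simp only [Equiv.Perm.mul_apply, Fin.revPerm_apply, Fin.rev_rev]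
    congr 1
    refine Finset.sum_equiv Fin.revPerm (fun j => ?_) (fun j _ => by simp)
    simp only [Finset.mem_filter, Finset.mem_univ, true_and, Fin.revPerm_apply]
    have h2 := Fin.rev_lt_rev (i := j.rev) (j := k)
    rw [Fin.rev_rev] at h2
    exact h2
  rw [h1, crossTerm, ← Finset.sum_add_distrib, ← Finset.sum_sub_distrib,
    ← Equiv.sum_comp π (fun i => hessian (component e f i) x (∑ j, gradient (component e f j) x)
      - hessian (component e f i) x (gradient (component e f i) x))]
  refine Finset.sum_congr rfl fun k _ => ?_
  rw [← map_add, ← map_sub, ← Equiv.sum_comp π]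
  congr 1
  rw [eq_sub_iff_add_eq, ← Finset.sum_filter_add_sum_filter_not Finset.univ
    (fun j : Fin n => j.1 < k.1) (fun j => gradient (component e f (π j)) x), add_assoc]
  congr 1
  have hs : (Finset.univ.filter fun j : Fin n => ¬ j.1 < k.1)
      = insert k (Finset.univ.filter fun j : Fin n => k.1 < j.1) := by
    ext j
    simp [Fin.ext_iff]
    omega
  rw [hs, Finset.sum_insert (by simp), add_comm]

/-- Right multiplication by the reversal permutes the orders, so doubling the sum pairs each order
with its reversal. -/
theorem sum_crossTerm (x : EuclideanSpace ℝ (Fin d)) :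
    (2 : ℝ) • ∑ π, crossTerm e f x π = (n.factorial : ℝ) •
      (∑ i, hessian (component e f i) x (∑ j, gradient (component e f j) x)
        - ∑ i, hessian (component e f i) x (gradient (component e f i) x)) := by
  rw [two_smul]
  nth_rewrite 2 [← Equiv.sum_comp (Equiv.mulRight (Fin.revPerm : Equiv.Perm (Fin n)))]
  simp only [Equiv.coe_mulRight]
  rw [← Finset.sum_add_distrib]
  simp only [crossTerm_add_crossTerm_rev, Finset.sum_const, Finset.card_univ, Fintype.card_perm,
    Fintype.card_fin, Nat.cast_smul_eq_nsmul]

end Epoch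

/-! ### Contraction of the mean squared distance in one epoch -/

section Contraction

variable {d n : ℕ} {e : Fin n → Finset (Fin d)} {f : (i : Fin n) → EuclideanSpace ℝ (e i) → ℝ}
  {xstar : EuclideanSpace ℝ (Fin d)} {μ L LH D G : ℝ}

theorem IsAdmissibleProblem.differentiable_objective
    (hP : IsAdmissibleProblem e f xstar μ L LH D G) : Differentiable ℝ (objective e f) := by
  have := hP.differentiable
  unfold objective
  fun_prop

theorem IsAdmissibleProblem.sum_gradient_eq (hP : IsAdmissibleProblem e f xstar μ L LH D G)
    (hn : 0 < n) (x : EuclideanSpace ℝ (Fin d)) :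
    ∑ i, gradient (component e f i) x = (n : ℝ) • gradient (objective e f) x := by
  have hn' : (n : ℝ) ≠ 0 := by positivity
  have hd : fderiv ℝ (objective e f) x = (1 / (n : ℝ)) • ∑ i, fderiv ℝ (component e f i) x := by
    have h := HasFDerivAt.fun_sum (u := Finset.univ)
      (fun i _ => ((hP.differentiable i) x).hasFDerivAt)
    exact (h.const_mul (1 / (n : ℝ))).fderiv
  refine ext_inner_right ℝ fun v => ?_
  rw [sum_inner, real_inner_smul_left, inner_gradient_left, hd]
  simp only [inner_gradient_left, _root_.smul_apply, _root_.sum_apply,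
    smul_eq_mul]
  field_simp

theorem IsAdmissibleProblem.gradient_objective_xstar
    (hP : IsAdmissibleProblem e f xstar μ L LH D G) : gradient (objective e f) xstar = 0 := by
  have : IsLocalMin (objective e f) xstar := Filter.Eventually.of_forall hP.minimizer
  rw [gradient, this.fderiv_eq_zero, map_zero]

theorem IsAdmissibleProblem.norm_gradient_objective_sub_le
    (hP : IsAdmissibleProblem e f xstar μ L LH D G) (hn : 0 < n)
    (x y : EuclideanSpace ℝ (Fin d)) :
    ‖gradient (objective e f) x - gradient (objective e f) y‖ ≤ L * ‖x - y‖ := by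
  have hn' : (0 : ℝ) < n := by positivity
  have h1 : (n : ℝ) • (gradient (objective e f) x - gradient (objective e f) y)
      = ∑ i, (gradient (component e f i) x - gradient (component e f i) y) := by
    rw [Finset.sum_sub_distrib, hP.sum_gradient_eq hn, hP.sum_gradient_eq hn, smul_sub]
  have h2 : ‖(n : ℝ) • (gradient (objective e f) x - gradient (objective e f) y)‖
      ≤ n * (L * ‖x - y‖) := by
    rw [h1]
    refine (norm_sum_le_of_le _ fun i _ => hP.smooth i x y).trans (by simp)
  rw [norm_smul, Real.norm_of_nonneg hn'.le] at h2
  exact le_of_mul_le_mul_left h2 hn'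

/-- Provides the sign of `L`, which is not assumed. A nonzero vector is needed to compare strong
monotonicity with the Lipschitz bound. -/
theorem IsAdmissibleProblem.modulus_le (hP : IsAdmissibleProblem e f xstar μ L LH D G)
    (hn : 0 < n) (hd : 0 < d) : μ ≤ L := by
  have : Nonempty (Fin d) := ⟨⟨0, hd⟩⟩
  obtain ⟨x, hx⟩ := exists_ne xstar
  have h1 := mul_sq_norm_le_inner_gradient hP.strong_convexity hP.gradient_objective_xstar x
  have h2 := hP.norm_gradient_objective_sub_le hn x xstar
  rw [hP.gradient_objective_xstar, sub_zero] at h2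
  have h3 := real_inner_le_norm (gradient (objective e f) x) (x - xstar)
  have h4 : 0 < ‖x - xstar‖ := norm_pos_iff.2 (sub_ne_zero.2 hx)
  have h5 : μ * ‖x - xstar‖ ^ 2 ≤ L * ‖x - xstar‖ ^ 2 := by
    nlinarith [mul_le_mul_of_nonneg_right h2 h4.le]
  exact le_of_mul_le_mul_right h5 (by positivity)

theorem IsAdmissibleProblem.hessian_constant_nonneg
    (hP : IsAdmissibleProblem e f xstar μ L LH D G) (hn : 0 < n) (hd : 0 < d) : 0 ≤ LH := by
  have : Nonempty (Fin d) := ⟨⟨0, hd⟩⟩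
  obtain ⟨x, hx⟩ := exists_ne xstar
  have h := (norm_nonneg _).trans (hP.hessian_lipschitz ⟨0, hn⟩ x xstar)
  exact nonneg_of_mul_nonneg_left h (norm_pos_iff.2 (sub_ne_zero.2 hx))

/-- Symmetry moves the Hessians onto x - x*. Taylor's formula from x to x*, where the full gradient
vanishes, then replaces ∑ H_i (x - x*) by U, with an error paired against ‖U‖ ≤ nG. -/
theorem IsAdmissibleProblem.inner_hessian_sum_le
    (hP : IsAdmissibleProblem e f xstar μ L LH D G) (hn : 0 < n) (hLH : 0 ≤ LH)
    {x : EuclideanSpace ℝ (Fin d)} (hx : ‖x - xstar‖ ≤ D) :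
    inner ℝ (x - xstar) (∑ i, hessian (component e f i) x (∑ j, gradient (component e f j) x))
      ≤ ‖∑ j, gradient (component e f j) x‖ ^ 2 + n ^ 2 * (LH * G) * ‖x - xstar‖ ^ 2 := by
  set U := ∑ j, gradient (component e f j) x with hU
  have h1 : inner ℝ (x - xstar) (∑ i, hessian (component e f i) x U)
      = inner ℝ (∑ i, hessian (component e f i) x (x - xstar)) U := by
    rw [inner_sum, sum_inner]
    exact Finset.sum_congr rfl fun i _ =>
      (inner_fderiv_gradient_comm (hP.differentiable i) (hP.differentiable_gradient i) x _ _).symm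
  have h2 : ‖∑ i, hessian (component e f i) x (x - xstar) - U‖ ≤ n * (LH * ‖x - xstar‖ ^ 2) := by
    have h0 : ∑ j, gradient (component e f j) xstar = 0 := by
      rw [hP.sum_gradient_eq hn, hP.gradient_objective_xstar, smul_zero]
    have h3 : ∑ i, hessian (component e f i) x (x - xstar) - U
        = ∑ i, (gradient (component e f i) (x + (xstar - x)) - gradient (component e f i) x
          - hessian (component e f i) x (xstar - x)) := by
      rw [Finset.sum_sub_distrib, Finset.sum_sub_distrib, add_sub_cancel, h0, ← hU,
        ← neg_sub x xstar]
      simp only [map_neg, Finset.sum_neg_distrib]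
      abel
    rw [h3, norm_sub_rev x xstar]
    refine (norm_sum_le_of_le _ fun i _ => norm_sub_sub_fderiv_le (hP.differentiable_gradient i) hLH
      (hP.hessian_lipschitz i) x _).trans (by simp)
  have h4 : ‖U‖ ≤ n * G :=
    (norm_sum_le_of_le _ fun i _ => hP.gradient_bound i x hx).trans (by simp)
  have h5 := real_inner_le_norm (∑ i, hessian (component e f i) x (x - xstar) - U) U
  rw [inner_sub_left, real_inner_self_eq_norm_sq] at h5
  have h6 := mul_le_mul h2 h4 (norm_nonneg _) (by positivity)
  rw [h1]
  calc _ ≤ ‖U‖ ^ 2 + n * (LH * ‖x - xstar‖ ^ 2) * (n * G) := by linarith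
    _ = _ := by ring

/-- Expansion of the squared distance to the minimizer after one epoch. -/
theorem IsAdmissibleProblem.sq_norm_epochIterate_sub_le
    (hP : IsAdmissibleProblem e f xstar μ L LH D G)
    (hL : 0 ≤ L) (hLH : 0 ≤ LH) (hG : 0 ≤ G) {γ : ℝ} (hγ : 0 ≤ γ) (π : Equiv.Perm (Fin n))
    (x : EuclideanSpace ℝ (Fin d))
    (hx : ∀ k ≤ n, ‖epochIterate (component e f) γ π x k - xstar‖ ≤ D) :
    ‖epochIterate (component e f) γ π x n - xstar‖ ^ 2 ≤
      (‖x - xstar‖ ^ 2 - 2 * γ * inner ℝ (x - xstar) (∑ i, gradient (component e f i) x)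
        + 9 / 8 * γ ^ 2 * ‖∑ i, gradient (component e f i) x‖ ^ 2
        + 9 * γ ^ 2 * (n * (L * (γ * (maxDegree e * G)))) ^ 2
        + 2 * γ * ‖x - xstar‖ * (n * (γ ^ 2 * (maxDegree e : ℝ) ^ 2 * (LH * G ^ 2 + L ^ 2 * G))))
      + 2 * γ ^ 2 * inner ℝ (x - xstar) (crossTerm e f x π) := by
  set a := x - xstar with ha
  set U := ∑ i, gradient (component e f i) x with hU
  set R := ∑ k : Fin n, (gradient (component e f (π k)) (epochIterate (component e f) γ π x k)
      - gradient (component e f (π k)) x) with hR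
  set S := crossTerm e f x π with hS
  have hRn : ‖R‖ ≤ n * (L * (γ * (maxDegree e * G))) :=
    (norm_sum_le_of_le _ fun k _ => hP.norm_gradient_sub_le hL hG hγ π x hx k).trans (by simp)
  have hR'n : ‖R + γ • S‖ ≤ n * (γ ^ 2 * (maxDegree e : ℝ) ^ 2 * (LH * G ^ 2 + L ^ 2 * G)) := by
    rw [hR, hS, crossTerm, Finset.smul_sum, ← Finset.sum_add_distrib]
    exact (norm_sum_le_of_le _ fun k _ =>
      hP.norm_gradient_sub_add_le hL hLH hG hγ π x hx k).trans (by simp)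
  have hy : epochIterate (component e f) γ π x n - xstar = a - γ • (U + R) := by
    rw [epochIterate_eq_sub_sum _ _ _ _ le_rfl, hR, Finset.sum_sub_distrib,
      Equiv.sum_comp π (fun i => gradient (component e f i) x), add_sub_cancel]
    simp only [Fin.is_lt, Finset.filter_true, ha]
    abel
  have h1 : inner ℝ a (U + R) = inner ℝ a U + inner ℝ a (R + γ • S) - γ * inner ℝ a S := by
    simp only [inner_add_right, real_inner_smul_right]
    ring
  have h2 : -(‖a‖ * ‖R + γ • S‖) ≤ inner ℝ a (R + γ • S) :=
    neg_le_of_abs_le (abs_real_inner_le_norm _ _)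
  -- Young's inequality with weight 1/8: the coefficient of ‖U‖² must stay close to 1 for later
  -- absorption.
  have h3 : ‖U + R‖ ^ 2 ≤ 9 / 8 * ‖U‖ ^ 2 + 9 * ‖R‖ ^ 2 := by
    have := norm_add_le U R
    nlinarith [norm_nonneg (U + R), sq_nonneg (‖U‖ - 8 * ‖R‖)]
  have h4 : ‖R‖ ^ 2 ≤ (n * (L * (γ * (maxDegree e * G)))) ^ 2 := by gcongr
  have h5 := mul_le_mul_of_nonneg_left hR'n (norm_nonneg a)
  have h6 : ‖U + R‖ ^ 2 ≤ 9 / 8 * ‖U‖ ^ 2 + 9 * (n * (L * (γ * (maxDegree e * G)))) ^ 2 := by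
    linarith
  have h7 := mul_le_mul_of_nonneg_left h6 (sq_nonneg γ)
  have h8 := mul_le_mul_of_nonneg_left (h2.trans' (neg_le_neg h5)) hγ
  rw [hy, norm_sub_sq_real, real_inner_smul_right, h1, norm_smul, mul_pow, Real.norm_eq_abs, sq_abs]
  linarith

/-- The noise added in one epoch. -/
noncomputable def epochNoise (μ L LH G γ : ℝ) (n m : ℕ) : ℝ :=
  2 * L ^ 2 * G ^ 2 / μ * γ ^ 3 * n
    + (9 * L ^ 2 * G ^ 2 + 6 * (LH * G ^ 2 + L ^ 2 * G) ^ 2 / μ ^ 2) * γ ^ 4 * n ^ 2 * m ^ 2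

/-- Here A = ‖x - x*‖, u = ⟨x - x*, U⟩ and q = ‖U‖². Of the gain 2γu, a part 17/12 pays for (9/8 +
1)γ²q, and 7/12 becomes a multiple of γnμA². The remaining terms use 1/12 + 1/8 + 1/8 of that,
leaving 7/12 - 1/3 = 1/4. -/
theorem scalar_contraction {μ L LH G γ n m A u q M : ℝ} (hμ : 0 < μ) (hL : 0 ≤ L) (hγ : 0 ≤ γ)
    (hn : 0 < n) (hm : 0 ≤ m) (hmn : m ≤ n) (h1 : γ * n * (L + μ) ≤ 2 / 3)
    (h2 : γ * n * (LH * G) ≤ μ / 12) (hq : q ≤ n * L * u) (hu : n * μ * A ^ 2 ≤ u) :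
    A ^ 2 - 2 * γ * u + 9 / 8 * γ ^ 2 * q + 9 * γ ^ 2 * (n * (L * (γ * (m * G)))) ^ 2
        + 2 * γ * A * (n * (γ ^ 2 * m ^ 2 * M))
        + γ ^ 2 * (q + n ^ 2 * (LH * G) * A ^ 2 + n * (L * G) * A)
      ≤ (1 - γ * n * μ / 4) * A ^ 2 + (2 * L ^ 2 * G ^ 2 / μ * γ ^ 3 * n
        + (9 * L ^ 2 * G ^ 2 + 6 * M ^ 2 / μ ^ 2) * γ ^ 4 * n ^ 2 * m ^ 2) := by
  have hu0 : 0 ≤ u := le_trans (by positivity) hu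
  have t1 : 17 / 8 * γ ^ 2 * q ≤ 17 / 12 * (γ * u) := by
    have a1 : γ * n * L ≤ 2 / 3 := by nlinarith [mul_nonneg (mul_nonneg hγ hn.le) hμ.le]
    have a2 : γ * (γ * q) ≤ γ * (2 / 3 * u) := by
      refine mul_le_mul_of_nonneg_left ?_ hγ
      calc γ * q ≤ γ * (n * L * u) := by gcongr
        _ = γ * n * L * u := by ring
        _ ≤ 2 / 3 * u := by gcongr
    linarith
  have t2 : 7 / 12 * (γ * n * μ * A ^ 2) ≤ 7 / 12 * (γ * u) := by
    have := mul_le_mul_of_nonneg_left hu hγ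
    linarith
  have t3 : γ ^ 2 * (n ^ 2 * (LH * G) * A ^ 2) ≤ γ * n * μ * A ^ 2 / 12 := by
    have := mul_le_mul_of_nonneg_left h2 (show 0 ≤ γ * n * A ^ 2 by positivity)
    linarith
  have t4 : γ ^ 2 * (n * (L * G) * A)
      ≤ γ * n * μ * A ^ 2 / 8 + 2 * L ^ 2 * G ^ 2 / μ * γ ^ 3 * n := by
    have : 0 ≤ γ * n / (8 * μ) * (μ * A - 4 * γ * L * G) ^ 2 := by positivity
    have e1 : γ * n / (8 * μ) * (μ * A - 4 * γ * L * G) ^ 2 = γ * n * μ * A ^ 2 / 8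
      + 2 * L ^ 2 * G ^ 2 / μ * γ ^ 3 * n - γ ^ 2 * (n * (L * G) * A) := by
      field_simp
      ring
    linarith
  have t5 : 2 * γ * A * (n * (γ ^ 2 * m ^ 2 * M))
      ≤ γ * n * μ * A ^ 2 / 8 + 8 * M ^ 2 / μ * γ ^ 5 * n * m ^ 4 := by
    have : 0 ≤ γ * n / (8 * μ) * (μ * A - 8 * (γ ^ 2 * m ^ 2 * M)) ^ 2 := by positivity
    have e1 : γ * n / (8 * μ) * (μ * A - 8 * (γ ^ 2 * m ^ 2 * M)) ^ 2 = γ * n * μ * A ^ 2 / 8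
      + 8 * M ^ 2 / μ * γ ^ 5 * n * m ^ 4 - 2 * γ * A * (n * (γ ^ 2 * m ^ 2 * M)) := by
      field_simp
      ring
    linarith
  -- One factor m² is weakened to n², and γnμ ≤ 2/3 lowers the power of γ; 16/3 is rounded up to 6.
  have t6 : 8 * M ^ 2 / μ * γ ^ 5 * n * m ^ 4 ≤ 6 * M ^ 2 / μ ^ 2 * γ ^ 4 * n ^ 2 * m ^ 2 := by
    have a1 : γ * n * μ ≤ 2 / 3 := by nlinarith [mul_nonneg (mul_nonneg hγ hn.le) hL]
    calc 8 * M ^ 2 / μ * γ ^ 5 * n * m ^ 4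
        = 8 * M ^ 2 / μ * γ ^ 5 * n * m ^ 2 * m ^ 2 := by ring
      _ ≤ 8 * M ^ 2 / μ * γ ^ 5 * n * m ^ 2 * n ^ 2 := by gcongr
      _ = 8 * M ^ 2 / μ ^ 2 * γ ^ 4 * n ^ 2 * m ^ 2 * (γ * n * μ) := by
          field_simp
      _ ≤ 8 * M ^ 2 / μ ^ 2 * γ ^ 4 * n ^ 2 * m ^ 2 * (2 / 3) := by gcongr
      _ ≤ _ := by
          have : 0 ≤ M ^ 2 / μ ^ 2 * γ ^ 4 * n ^ 2 * m ^ 2 := by positivity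
          rw [mul_div_assoc, mul_div_assoc]
          linarith
  linarith

/-- Contraction in one epoch, on average over the order. -/
theorem IsAdmissibleProblem.sum_perm_sq_norm_le
    (hP : IsAdmissibleProblem e f xstar μ L LH D G) (hn : 0 < n) (hμ : 0 < μ) (hL : 0 < L)
    (hLH : 0 ≤ LH) {γ : ℝ} (hγ : 0 ≤ γ)
    (h1 : γ * n * (L + μ) ≤ 2 / 3) (h2 : γ * n * (LH * G) ≤ μ / 12)
    (x : EuclideanSpace ℝ (Fin d))
    (hx : ∀ π, ∀ k ≤ n, ‖epochIterate (component e f) γ π x k - xstar‖ ≤ D) :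
    1 / (n.factorial : ℝ) * ∑ π, ‖epochIterate (component e f) γ π x n - xstar‖ ^ 2 ≤
      (1 - γ * n * μ / 4) * ‖x - xstar‖ ^ 2 + epochNoise μ L LH G γ n (maxDegree e) := by
  have hx0 : ‖x - xstar‖ ≤ D := by simpa [epochIterate] using hx 1 0 (Nat.zero_le n)
  have hG : 0 ≤ G := (norm_nonneg _).trans (hP.gradient_bound ⟨0, hn⟩ x hx0)
  have hn' : (0 : ℝ) < n := by positivity
  have hfac : (0 : ℝ) < n.factorial := by positivity
  set U := ∑ i, gradient (component e f i) x with hU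
  set V := ∑ i, hessian (component e f i) x (gradient (component e f i) x) with hV
  have hUF := hP.sum_gradient_eq hn x
  have hq : ‖U‖ ^ 2 ≤ n * L * inner ℝ (x - xstar) U := by
    have := sq_norm_gradient_le hP.differentiable_objective hL
      (hP.norm_gradient_objective_sub_le hn)
      (fun x y => le_trans (le_add_of_nonneg_right (by positivity)) (hP.strong_convexity x y))
      hP.gradient_objective_xstar x
    rw [hU, hUF, norm_smul, real_inner_smul_right, real_inner_comm, Real.norm_of_nonneg hn'.le]
    nlinarith [mul_le_mul_of_nonneg_left this (sq_nonneg (n : ℝ))]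
  have hu : n * μ * ‖x - xstar‖ ^ 2 ≤ inner ℝ (x - xstar) U := by
    have := mul_sq_norm_le_inner_gradient hP.strong_convexity hP.gradient_objective_xstar x
    rw [hU, hUF, real_inner_smul_right, real_inner_comm, mul_assoc]
    gcongr
  have hVn : ‖V‖ ≤ n * (L * G) :=
    (norm_sum_le_of_le _ fun i _ => (hessian (component e f i) x).le_of_opNorm_le_of_le
      (hP.norm_hessian_le hL.le i x) (hP.gradient_bound i x hx0)).trans (by simp)
  have hS := hP.inner_hessian_sum_le hn hLH hx0
  have hVa : -inner ℝ (x - xstar) V ≤ n * (L * G) * ‖x - xstar‖ := by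
    have := abs_le.1 (abs_real_inner_le_norm (x - xstar) V)
    nlinarith [mul_le_mul_of_nonneg_left hVn (norm_nonneg (x - xstar))]
  -- The factor 2 of the expansion is consumed by the pairing of orders.
  have hcross : 1 / (n.factorial : ℝ) *
      (2 * γ ^ 2 * ∑ π, inner ℝ (x - xstar) (crossTerm e f x π))
      ≤ γ ^ 2 * (‖U‖ ^ 2 + n ^ 2 * (LH * G) * ‖x - xstar‖ ^ 2
        + n * (L * G) * ‖x - xstar‖) := by
    have h3 := congrArg (inner ℝ (x - xstar)) (sum_crossTerm (e := e) (f := f) x)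
    rw [real_inner_smul_right, real_inner_smul_right, inner_sum, inner_sub_right] at h3
    calc _ = γ ^ 2 * (1 / (n.factorial : ℝ) *
          (2 * ∑ π, inner ℝ (x - xstar) (crossTerm e f x π))) := by ring
      _ = γ ^ 2 * (inner ℝ (x - xstar) (∑ i, hessian (component e f i) x U)
          - inner ℝ (x - xstar) V) := by
          rw [h3, ← mul_assoc (1 / (n.factorial : ℝ)), one_div_mul_cancel hfac.ne', one_mul]
      _ ≤ _ := by
          gcongr
          linarith
  refine le_trans ?_ (scalar_contraction (M := LH * G ^ 2 + L ^ 2 * G) hμ hL.le hγ hn'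
    (Nat.cast_nonneg (maxDegree e)) (by exact_mod_cast maxDegree_le) h1 h2 hq hu)
  refine (mul_le_mul_of_nonneg_left (Finset.sum_le_sum fun π _ =>
    hP.sq_norm_epochIterate_sub_le hL.le hLH hG hγ π x (hx π)) (by positivity)).trans ?_
  rw [Finset.sum_add_distrib, mul_add, Finset.sum_const, Finset.card_univ, Fintype.card_perm,
    Fintype.card_fin, nsmul_eq_mul, ← mul_assoc, one_div_mul_cancel hfac.ne', one_mul,
    ← Finset.mul_sum]
  exact add_le_add_right hcross _

end Contraction

open MeasureTheory ProbabilityTheory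

/-! ### Independence of the shuffles, and iteration over epochs -/

section Expectation

variable {Ω : Type u} [MeasurableSpace Ω] {P : Measure Ω}

/-- Averaging over a uniformly distributed variable that is independent of the rest. -/
theorem integral_eq_integral_average [IsProbabilityMeasure P]
    {α β : Type*} [Fintype α] [Finite β]
    [MeasurableSpace α] [DiscreteMeasurableSpace α] [MeasurableSpace β] [DiscreteMeasurableSpace β]
    {Z : Ω → α} {Y : Ω → β} (hZ : Measurable Z) (hY : Measurable Y) (hind : IndepFun Z Y P)
    {c : ℝ} (hc : ∀ a, P.real {ω | Z ω = a} = c) (φ : α → β → ℝ) :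
    ∫ ω, φ (Z ω) (Y ω) ∂P = ∫ ω, c * ∑ a, φ a (Y ω) ∂P := by
  classical
  have hint : ∀ ψ : β → ℝ, Integrable (fun ω => ψ (Y ω)) P := fun ψ =>
    (Integrable.of_finite (μ := P.map Y) (f := ψ)).comp_measurable hY
  have hmul : ∀ a, IndepFun (fun ω => if Z ω = a then (1 : ℝ) else 0) (fun ω => φ a (Y ω)) P :=
    fun a => hind.comp (φ := fun z => if z = a then (1 : ℝ) else 0) (ψ := φ a)
      (Measurable.of_discrete) (Measurable.of_discrete)
  have hmeas : ∀ a, Measurable (fun ω => if Z ω = a then (1 : ℝ) else 0) := fun a =>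
    (Measurable.of_discrete (f := fun z : α => if z = a then (1 : ℝ) else 0)).comp hZ
  have hind_int : ∀ a, ∫ ω, (if Z ω = a then (1 : ℝ) else 0) ∂P = c := fun a => by
    have hs : MeasurableSet {ω | Z ω = a} := hZ (MeasurableSet.of_discrete (s := {a}))
    rw [← hc a, ← integral_indicator_one hs]
    rfl
  -- The integrand is split by the value of `Z`; independence factors each piece.
  calc ∫ ω, φ (Z ω) (Y ω) ∂P
      = ∫ ω, ∑ a, (if Z ω = a then (1 : ℝ) else 0) * φ a (Y ω) ∂P := by simp
    _ = ∑ a, ∫ ω, (if Z ω = a then (1 : ℝ) else 0) * φ a (Y ω) ∂P := by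
        refine integral_finsetSum _ fun a _ => ?_
        refine (hint (φ a)).bdd_mul (c := 1) (hmeas a).aestronglyMeasurable
          (Filter.Eventually.of_forall fun ω => ?_)
        split_ifs <;> simp
    _ = ∑ a, c * ∫ ω, φ a (Y ω) ∂P := by
        refine Finset.sum_congr rfl fun a _ => ?_
        rw [(hmul a).integral_fun_mul_eq_mul_integral (hmeas a).aestronglyMeasurable
          (hint (φ a)).aestronglyMeasurable, hind_int]
    _ = ∫ ω, c * ∑ a, φ a (Y ω) ∂P := by
        rw [integral_const_mul, integral_finsetSum _ fun a _ => hint (φ a), Finset.mul_sum]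

variable {d n : ℕ}

theorem epochStart_congr (g : Fin n → EuclideanSpace ℝ (Fin d) → ℝ) (γ : ℝ)
    {σ σ' : ℕ → Equiv.Perm (Fin n)} (x₀ : EuclideanSpace ℝ (Fin d)) {t : ℕ}
    (h : ∀ s < t, σ s = σ' s) : epochStart g γ σ x₀ t = epochStart g γ σ' x₀ t := by
  induction t with
  | zero => rfl
  | succ t ih =>
    rw [epochStart, epochStart, h t t.lt_succ_self, ih fun s hs => h s (hs.trans t.lt_succ_self)]

/-- An almost sure property that depends on finitely many of the permutations holds for every
choice of them. -/
theorem IsUniformShuffling.forall_of_ae {σ : ℕ → Ω → Equiv.Perm (Fin n)}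
    (hσ : IsUniformShuffling P σ) {l : ℕ} {p : (ℕ → Equiv.Perm (Fin n)) → Prop}
    (hp : ∀ s s', (∀ t < l, s t = s' t) → p s → p s')
    (hae : ∀ᵐ ω ∂P, p fun t => σ t ω) (s : ℕ → Equiv.Perm (Fin n)) : p s := by
  by_contra hs
  -- A prescribed choice of the first `l` permutations has positive probability, a product of
  -- factors 1/n!, so it cannot lie in a null set.
  have h1 : P (⋂ i ∈ Finset.range l, σ i ⁻¹' {s i}) = ∏ i ∈ Finset.range l, P (σ i ⁻¹' {s i}) :=
    hσ.indep.measure_inter_preimage_eq_mul (Finset.range l) (fun _ _ => trivial)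
  have h2 : P (⋂ i ∈ Finset.range l, σ i ⁻¹' {s i}) = 0 := by
    refine measure_mono_null (t := {ω | ¬ p fun t => σ t ω})
      (fun ω hω hpω => hs (hp _ _ ?_ hpω)) (ae_iff.1 hae)
    intro t ht
    simpa using Set.mem_iInter₂.1 hω t (Finset.mem_range.2 ht)
  rw [h2] at h1
  obtain ⟨i, -, hi⟩ := Finset.prod_eq_zero_iff.1 h1.symm
  have h3 := hσ.uniform i (s i)
  have h4 : P.real {ω | σ i ω = s i} = 0 := by
    rw [measureReal_def]
    exact (ENNReal.toReal_eq_zero_iff _).2 (Or.inl hi)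
  rw [h4] at h3
  have : (0 : ℝ) < 1 / n.factorial := by positivity
  exact this.ne h3

/-- The expectation after one more epoch is the expectation of the average over all orders. -/
theorem IsUniformShuffling.integral_epochStart_succ [IsProbabilityMeasure P]
    {σ : ℕ → Ω → Equiv.Perm (Fin n)}
    (hσ : IsUniformShuffling P σ) (g : Fin n → EuclideanSpace ℝ (Fin d) → ℝ) (γ : ℝ)
    (x₀ : EuclideanSpace ℝ (Fin d)) (t : ℕ) (φ : EuclideanSpace ℝ (Fin d) → ℝ) :
    Integrable (fun ω => φ (epochStart g γ (fun s => σ s ω) x₀ t)) P ∧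
    Integrable (fun ω => 1 / (n.factorial : ℝ) *
      ∑ π, φ (epochIterate g γ π (epochStart g γ (fun s => σ s ω) x₀ t) n)) P ∧
    ∫ ω, φ (epochStart g γ (fun s => σ s ω) x₀ (t + 1)) ∂P = ∫ ω, 1 / (n.factorial : ℝ) *
      ∑ π, φ (epochIterate g γ π (epochStart g γ (fun s => σ s ω) x₀ t) n) ∂P := by
  let _ : MeasurableSpace (Equiv.Perm (Fin n)) := ⊤
  have : DiscreteMeasurableSpace (Equiv.Perm (Fin n)) := ⟨fun _ => trivial⟩
  have hmeas : ∀ i, Measurable (σ i) := fun i =>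
    measurable_to_countable' fun π => hσ.measurable i π
  let Y : Ω → (Finset.range t → Equiv.Perm (Fin n)) := fun ω i => σ i ω
  have hY : Measurable Y := measurable_pi_lambda _ fun i => hmeas i
  have hind : IndepFun (σ t) Y P := by
    have h := hσ.indep.indepFun_finset {t} (Finset.range t) (by simp) hmeas
    have hπ : Measurable fun w : ({t} : Finset ℕ) → Equiv.Perm (Fin n) =>
        w ⟨t, Finset.mem_singleton_self t⟩ := measurable_pi_apply _
    exact h.comp hπ measurable_id
  -- The start of epoch `t` uses only the first `t` permutations; the default `1` is never read.
  let X : (Finset.range t → Equiv.Perm (Fin n)) → EuclideanSpace ℝ (Fin d) := fun w =>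
    epochStart g γ (fun s => if h : s ∈ Finset.range t then w ⟨s, h⟩ else 1) x₀ t
  have hX : ∀ ω, epochStart g γ (fun s => σ s ω) x₀ t = X (Y ω) := fun ω =>
    epochStart_congr g γ x₀ fun s hs => by simp [Y, hs]
  have hint : ∀ ψ : (Finset.range t → Equiv.Perm (Fin n)) → ℝ,
      Integrable (fun ω => ψ (Y ω)) P := fun ψ =>
    (Integrable.of_finite (μ := P.map Y) (f := ψ)).comp_measurable hY
  simp only [epochStart, hX]
  exact ⟨hint fun w => φ (X w),
    hint fun w => 1 / (n.factorial : ℝ) * ∑ π, φ (epochIterate g γ π (X w) n),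
    integral_eq_integral_average (hmeas t) hY hind (hσ.uniform t)
      fun π w => φ (epochIterate g γ π (X w) n)⟩

variable {e : Fin n → Finset (Fin d)} {f : (i : Fin n) → EuclideanSpace ℝ (e i) → ℝ}
  {xstar x₀ : EuclideanSpace ℝ (Fin d)} {σ : ℕ → Ω → Equiv.Perm (Fin n)} {l : ℕ} {μ L LH D G : ℝ}

/-- Averaging over orders needs the bound for every order from the same starting point. Changing the
permutation of epoch `t` leaves the start of that epoch unchanged. -/
theorem IsAdmissibleRun.norm_sub_le (h : IsAdmissibleRun P e f xstar x₀ σ l μ L LH D G)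
    (s : ℕ → Equiv.Perm (Fin n)) {t : ℕ} (ht : t < l) {k : ℕ} (hk : k ≤ n)
    (π : Equiv.Perm (Fin n)) :
    ‖epochIterate (component e f) (stepSize μ (l * n)) π
      (epochStart (component e f) (stepSize μ (l * n)) s x₀ t) k - xstar‖ ≤ D := by
  have h1 := h.shuffling.forall_of_ae (l := l) (p := fun s => ∀ t < l, ∀ k ≤ n,
    ‖epochIterate (component e f) (stepSize μ (l * n)) (s t)
      (epochStart (component e f) (stepSize μ (l * n)) s x₀ t) k - xstar‖ ≤ D)
    (fun s s' hs hp t ht k hk => by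
      rw [← hs t ht, ← epochStart_congr _ _ x₀ fun r hr => hs r (hr.trans ht)]
      exact hp t ht k hk) h.bounded_iterates (Function.update s t π) t ht k hk
  rw [Function.update_self] at h1
  rwa [epochStart_congr (σ' := s) _ _ x₀ fun r hr => Function.update_of_ne hr.ne _ _] at h1

/-- The error after `t` epochs, by iterating the contraction. -/
theorem IsAdmissibleRun.integral_sq_norm_le [IsProbabilityMeasure P]
    (h : IsAdmissibleRun P e f xstar x₀ σ l μ L LH D G)
    (hμ : 0 < μ) (hL : 0 < L) (hLH : 0 ≤ LH) (hγ : 0 < stepSize μ (l * n))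
    (h1 : stepSize μ (l * n) * n * (L + μ) ≤ 2 / 3)
    (h2 : stepSize μ (l * n) * n * (LH * G) ≤ μ / 12) {t : ℕ} (ht : t ≤ l) :
    ∫ ω, ‖epochStart (component e f) (stepSize μ (l * n)) (fun s => σ s ω) x₀ t - xstar‖ ^ 2 ∂P ≤
      (1 - stepSize μ (l * n) * n * μ / 4) ^ t * D ^ 2
        + epochNoise μ L LH G (stepSize μ (l * n)) n (maxDegree e)
          / (stepSize μ (l * n) * n * μ / 4) := by
  have hn := h.n_pos
  have hn' : (0 : ℝ) < n := by positivity
  have hNnn : 0 ≤ epochNoise μ L LH G (stepSize μ (l * n)) n (maxDegree e) := by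
    unfold epochNoise
    positivity
  have hc0 : 0 < stepSize μ (l * n) * n * μ / 4 := by positivity
  have hc1 : stepSize μ (l * n) * n * μ / 4 ≤ 1 := by
    nlinarith [mul_nonneg (mul_nonneg hγ.le hn'.le) hL.le]
  set γ := stepSize μ (l * n)
  set N := epochNoise μ L LH G γ n (maxDegree e)
  set c := γ * n * μ / 4 with hc
  induction t with
  | zero =>
    have h0 := h.norm_sub_le (fun _ => 1) h.l_pos (Nat.zero_le n) 1
    simp only [epochIterate, epochStart] at h0
    simp only [epochStart, integral_const, probReal_univ, one_smul, pow_zero, one_mul]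
    have : ‖x₀ - xstar‖ ^ 2 ≤ D ^ 2 := by gcongr
    have : 0 ≤ N / c := by positivity
    linarith
  | succ t ih =>
    obtain ⟨i1, i2, heq⟩ := h.shuffling.integral_epochStart_succ (component e f) γ x₀ t
      (fun x => ‖x - xstar‖ ^ 2)
    rw [heq]
    have hstep : ∫ ω, 1 / (n.factorial : ℝ) * ∑ π, ‖epochIterate (component e f) γ π
        (epochStart (component e f) γ (fun s => σ s ω) x₀ t) n - xstar‖ ^ 2 ∂P
        ≤ ∫ ω, ((1 - c) * ‖epochStart (component e f) γ (fun s => σ s ω) x₀ t - xstar‖ ^ 2 + N)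
          ∂P :=
      integral_mono i2 ((i1.const_mul _).add (integrable_const _)) fun ω =>
        h.problem.sum_perm_sq_norm_le hn hμ hL hLH hγ.le h1 h2 _
          fun π k hk => h.norm_sub_le _ ht hk π
    rw [integral_add (i1.const_mul _) (integrable_const _), integral_const_mul (1 - c),
      integral_const, probReal_univ, one_smul] at hstep
    have hm := mul_le_mul_of_nonneg_left (ih (Nat.le_of_succ_le ht)) (sub_nonneg.2 hc1)
    -- N/c is the fixed point of r ↦ (1 - c)r + N.
    refine hstep.trans ((add_le_add_left hm N).trans (le_of_eq ?_))
    field_simp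
    ring

end Expectation

/-! ### Choice of the step size and the final rate -/

section Rate

variable {Ω : Type u} [MeasurableSpace Ω] {P : Measure Ω} {d n : ℕ}
  {e : Fin n → Finset (Fin d)} {f : (i : Fin n) → EuclideanSpace ℝ (e i) → ℝ}
  {xstar x₀ : EuclideanSpace ℝ (Fin d)} {σ : ℕ → Ω → Equiv.Perm (Fin n)} {l : ℕ} {μ L LH D G : ℝ}

/-- The constant of the convergence rate. -/
noncomputable def rateConstant (μ L LH D G : ℝ) : ℝ :=
  8 * D ^ 2 + 1024 * L ^ 2 * G ^ 2 / μ ^ 4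
    + 2048 * (9 * L ^ 2 * G ^ 2 + 6 * (LH * G ^ 2 + L ^ 2 * G) ^ 2 / μ ^ 2) / μ ^ 4 + 1

theorem rateConstant_pos : 0 < rateConstant μ L LH D G := by
  unfold rateConstant
  positivity

theorem sparsityFactor_nonneg : 0 ≤ sparsityFactor e := by
  unfold sparsityFactor
  positivity

/-- The condition on the number of epochs, in terms of the step size. -/
theorem stepSize_bounds {T : ℝ} (hn : 0 < n) (hl : 0 < l) (hμ : 0 < μ) (hL : 0 ≤ L) (hT : T = l * n)
    (h : T / Real.log T > threshold μ L LH D G * n) (hLHL : 0 ≤ LH * L * D) :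
    1 / 2 ≤ Real.log T ∧ 8 * Real.log T / (T * μ) * n * (L + μ) ≤ 2 / 3 ∧
      8 * Real.log T / (T * μ) * n * (LH * G) ≤ μ / 12 := by
  have hn' : (0 : ℝ) < n := by positivity
  have hl' : (0 : ℝ) < l := by positivity
  have hC1 : 12 * (1 + L / μ) ≤ threshold μ L LH D G := le_max_right _ _
  have hC2 : 32 / μ ^ 2 * (LH * L * D + 3 * LH * G) ≤ threshold μ L LH D G := le_max_left _ _
  have hC0 : 0 < threshold μ L LH D G := lt_of_lt_of_le (by positivity) hC1
  have hT1 : (1 : ℝ) ≤ T := by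
    rw [hT]
    exact_mod_cast Nat.mul_pos hl hn
  have hpos : 0 < T / Real.log T := lt_trans (by positivity) h
  have hlog : 0 < Real.log T := by
    -- For T = 1 the quotient T / log T is 0 by convention, which contradicts the threshold
    -- condition.
    rcases (Real.log_nonneg hT1).eq_or_lt with h0 | h0
    · rw [← h0, div_zero] at hpos
      exact absurd hpos (lt_irrefl _)
    · exact h0
  have hT2 : (2 : ℝ) ≤ T := by
    have h1 : T ≠ 1 := fun h1 => by simp [h1] at hlog
    rw [hT] at hT1 h1 ⊢
    norm_cast at hT1 h1 ⊢
    omega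
  have hCl : threshold μ L LH D G * Real.log T ≤ l := by
    rw [gt_iff_lt, lt_div_iff₀ hlog, hT] at h
    rw [hT]
    have : threshold μ L LH D G * Real.log (l * n) * n ≤ l * n := by linarith
    exact le_of_mul_le_mul_right this hn'
  have hγ : 8 * Real.log T / (T * μ) * n = 8 * Real.log T / (l * μ) := by
    rw [hT]
    field_simp
  refine ⟨?_, ?_, ?_⟩
  · have := Real.log_le_log (by norm_num) hT2
    linarith [Real.log_two_gt_d9]
  · rw [hγ, div_mul_eq_mul_div, div_le_iff₀ (by positivity)]
    have h1 := (mul_le_mul_of_nonneg_right hC1 hlog.le).trans hCl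
    have h2 := mul_le_mul_of_nonneg_right h1 hμ.le
    have h3 : 12 * (1 + L / μ) * Real.log T * μ = 12 * (L + μ) * Real.log T := by
      field_simp
      ring
    linarith
  · rw [hγ, div_mul_eq_mul_div, div_le_iff₀ (by positivity)]
    have h1 := (mul_le_mul_of_nonneg_right hC2 hlog.le).trans hCl
    have h2 := mul_le_mul_of_nonneg_right h1 (sq_nonneg μ)
    have h3 : 32 / μ ^ 2 * (LH * L * D + 3 * LH * G) * Real.log T * μ ^ 2
        = 32 * (LH * L * D) * Real.log T + 96 * (LH * G) * Real.log T := by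
      field_simp
      ring
    -- Without this nonnegative term the threshold still gives 96 · LH · G · log T ≤ lμ², and 8/96 =
    -- 1/12.
    have h4 : 0 ≤ LH * L * D * Real.log T := by positivity
    linarith

theorem IsAdmissibleRun.expectedError_le [IsProbabilityMeasure P]
    (h : IsAdmissibleRun P e f xstar x₀ σ l μ L LH D G) (hμ : 0 < μ) {T : ℕ} (hT : T = l * n) :
    expectedError P e f xstar x₀ σ l μ ≤ rateConstant μ L LH D G * Real.log T ^ 3 *
      (1 / (T : ℝ) ^ 2 + sparsityFactor e ^ 2 * (n : ℝ) ^ 3 / (T : ℝ) ^ 3) := by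
  have hn := h.n_pos
  have hl := h.l_pos
  have hlog0 : 0 ≤ Real.log T := Real.log_natCast_nonneg T
  -- In dimension zero the signs of `L` and `LH` are undetermined, but the error is zero.
  rcases Nat.eq_zero_or_pos d with rfl | hd
  · have h0 : expectedError P e f xstar x₀ σ l μ = 0 := by
      simp [expectedError, Subsingleton.elim _ xstar]
    rw [h0]
    have := (rateConstant_pos (μ := μ) (L := L) (LH := LH) (D := D) (G := G)).le
    positivity
  have hL : 0 < L := hμ.trans_le (h.problem.modulus_le hn hd)
  have hLH := h.problem.hessian_constant_nonneg hn hd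
  have hx0 : ‖x₀ - xstar‖ ≤ D := by
    simpa [epochIterate, epochStart] using h.norm_sub_le (fun _ => 1) hl (Nat.zero_le n) 1
  have hD : 0 ≤ D := (norm_nonneg _).trans hx0
  have hG : 0 ≤ G := (norm_nonneg _).trans (h.problem.gradient_bound ⟨0, hn⟩ x₀ hx0)
  have hTr : (T : ℝ) = l * n := by rw [hT]; push_cast; rfl
  have hn' : (0 : ℝ) < n := by positivity
  have hl' : (0 : ℝ) < l := by positivity
  have hT' : (0 : ℝ) < T := by rw [hTr]; positivity
  have hen := h.enough_epochs
  rw [← hT] at hen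
  obtain ⟨hlog, h1, h2⟩ := stepSize_bounds hn hl hμ hL.le hTr hen (by positivity)
  have hst : stepSize μ (l * n) = 8 * Real.log T / (T * μ) := by rw [stepSize, ← hT]
  rw [← hst] at h1 h2
  have hγ : 0 < stepSize μ (l * n) := by
    rw [hst]
    have : 0 < Real.log T := by linarith
    positivity
  refine (h.integral_sq_norm_le hμ hL hLH hγ h1 h2 le_rfl).trans ?_
  -- The step size is chosen so that l · γnμ/4 = 2 log T.
  have hb1 : (1 - stepSize μ (l * n) * n * μ / 4) ^ l ≤ 1 / (T : ℝ) ^ 2 := by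
    have hc1 : 0 ≤ 1 - stepSize μ (l * n) * n * μ / 4 := by
      nlinarith [mul_nonneg (mul_nonneg hγ.le hn'.le) hL.le]
    have hexp := Real.add_one_le_exp (-(stepSize μ (l * n) * n * μ / 4))
    calc (1 - stepSize μ (l * n) * n * μ / 4) ^ l
        ≤ (Real.exp (-(stepSize μ (l * n) * n * μ / 4))) ^ l := by
          gcongr
          linarith
      _ = Real.exp (-(2 * Real.log T)) := by
          rw [← Real.exp_nat_mul, hst]
          congr 1
          rw [hTr]
          field_simp
          ring
      _ = 1 / (T : ℝ) ^ 2 := by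
          rw [Real.exp_neg, two_mul, Real.exp_add, Real.exp_log hT', one_div, sq]
  set lg := Real.log T with hlg
  set ρ := sparsityFactor e with hρ
  set B := 9 * L ^ 2 * G ^ 2 + 6 * (LH * G ^ 2 + L ^ 2 * G) ^ 2 / μ ^ 2 with hB
  have hB0 : 0 ≤ B := by positivity
  -- Dividing by γnμ/4 leaves γ² and γ³nm²; here m = ρn, 512 = 2 · 4 · 8² and 2048 = 4 · 8³.
  have hb2 : epochNoise μ L LH G (stepSize μ (l * n)) n (maxDegree e)
      / (stepSize μ (l * n) * n * μ / 4) = 512 * L ^ 2 * G ^ 2 / μ ^ 4 * lg ^ 2 * (1 / (T : ℝ) ^ 2)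
        + 2048 * B / μ ^ 4 * lg ^ 3 * (ρ ^ 2 * (n : ℝ) ^ 3 / (T : ℝ) ^ 3) := by
    have hlgp : 0 < lg := by linarith
    rw [epochNoise, ← hB, ← sparsityFactor_mul_eq hn, ← hρ, hst]
    field_simp
    ring
  rw [hb2]
  -- Since log T ≥ 1/2, lower powers of log T are raised to the cube at the cost of the factors 2
  -- and 8.
  have hlg2 : lg ^ 2 ≤ 2 * lg ^ 3 := by nlinarith [sq_nonneg lg]
  have hlg0 : 1 ≤ 8 * lg ^ 3 := by nlinarith [sq_nonneg lg]
  have hK : rateConstant μ L LH D G = 8 * D ^ 2 + 1024 * L ^ 2 * G ^ 2 / μ ^ 4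
    + 2048 * B / μ ^ 4 + 1 := rfl
  set Q := ρ ^ 2 * (n : ℝ) ^ 3 / (T : ℝ) ^ 3
  have hQ : 0 ≤ Q := by positivity
  set I := 1 / (T : ℝ) ^ 2
  have hI : 0 ≤ I := by positivity
  set B' := 2048 * B / μ ^ 4
  have hB' : 0 ≤ B' := by positivity
  have hA : 1024 * L ^ 2 * G ^ 2 / μ ^ 4 = 2 * (512 * L ^ 2 * G ^ 2 / μ ^ 4) := by ring
  rw [hA] at hK
  set A := 512 * L ^ 2 * G ^ 2 / μ ^ 4
  have hA0 : 0 ≤ A := by positivity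
  calc (1 - stepSize μ (l * n) * n * μ / 4) ^ l * D ^ 2 + (A * lg ^ 2 * I + B' * lg ^ 3 * Q)
      ≤ I * (D ^ 2 * (8 * lg ^ 3)) + (A * (2 * lg ^ 3) * I + B' * lg ^ 3 * Q) := by
        gcongr
        exact le_mul_of_one_le_right (sq_nonneg D) hlg0
    _ ≤ rateConstant μ L LH D G * lg ^ 3 * (I + Q) := by
        rw [hK]
        have e1 : 0 ≤ lg ^ 3 * I := by positivity
        have e2 : 0 ≤ lg ^ 3 * Q := by positivity
        have e3 : 0 ≤ B' * (lg ^ 3 * I) := by positivity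
        have e4 : 0 ≤ D ^ 2 * (lg ^ 3 * Q) := by positivity
        have e5 : 0 ≤ A * (lg ^ 3 * Q) := by positivity
        linarith

/-- With bounded degrees of the intersection graph the second term of the rate is redundant. -/
theorem sparsity_term_le {c T : ℝ} (hn : 0 < n) (hnT : (n : ℝ) ≤ T) (hc : sparsityFactor e ≤ c / n) :
    1 / T ^ 2 + sparsityFactor e ^ 2 * (n : ℝ) ^ 3 / T ^ 3 ≤ (1 + c ^ 2) * (1 / T ^ 2) := by
  have hn' : (0 : ℝ) < n := by positivity
  have hT : 0 < T := hn'.trans_le hnT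
  have h1 : sparsityFactor e ^ 2 * (n : ℝ) ^ 3 / T ^ 3 ≤ c ^ 2 * (1 / T ^ 2) :=
    calc sparsityFactor e ^ 2 * (n : ℝ) ^ 3 / T ^ 3
        ≤ (c / n) ^ 2 * (n : ℝ) ^ 3 / T ^ 3 := by
          have := sparsityFactor_nonneg (e := e)
          gcongr
      _ = c ^ 2 * n / T ^ 3 := by field_simp
      _ ≤ c ^ 2 * T / T ^ 3 := by gcongr
      _ = c ^ 2 * (1 / T ^ 2) := by field_simp
  linarith

end Rate

end RandomShuffle

theorem theorem4 :
    ∃ p : ℕ, ∀ μ L LH D G : ℝ, 0 < μ →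
      (∃ K : ℝ, 0 < K ∧
        ∀ (d n : ℕ) (e : Fin n → Finset (Fin d))
          (f : (i : Fin n) → EuclideanSpace ℝ (e i) → ℝ)
          (xstar x₀ : EuclideanSpace ℝ (Fin d))
          (Ω : Type u) [MeasurableSpace Ω] (P : MeasureTheory.Measure Ω)
          [MeasureTheory.IsProbabilityMeasure P]
          (σ : ℕ → Ω → Equiv.Perm (Fin n)) (l T : ℕ), T = l * n →
          RandomShuffle.IsAdmissibleRun P e f xstar x₀ σ l μ L LH D G →
          RandomShuffle.expectedError P e f xstar x₀ σ l μ ≤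
            K * Real.log T ^ p *
              (1 / (T : ℝ) ^ 2 + RandomShuffle.sparsityFactor e ^ 2 * (n : ℝ) ^ 3 / (T : ℝ) ^ 3)) ∧
      (∀ c : ℝ, ∃ K : ℝ, 0 < K ∧
        ∀ (d n : ℕ) (e : Fin n → Finset (Fin d))
          (f : (i : Fin n) → EuclideanSpace ℝ (e i) → ℝ)
          (xstar x₀ : EuclideanSpace ℝ (Fin d))
          (Ω : Type u) [MeasurableSpace Ω] (P : MeasureTheory.Measure Ω)
          [MeasureTheory.IsProbabilityMeasure P]
          (σ : ℕ → Ω → Equiv.Perm (Fin n)) (l T : ℕ), T = l * n →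
          RandomShuffle.IsAdmissibleRun P e f xstar x₀ σ l μ L LH D G →
          RandomShuffle.sparsityFactor e ≤ c / n →
          RandomShuffle.expectedError P e f xstar x₀ σ l μ ≤
            K * Real.log T ^ p * (1 / (T : ℝ) ^ 2)) := by
  refine ⟨3, fun μ L LH D G hμ => ⟨⟨RandomShuffle.rateConstant μ L LH D G,
    RandomShuffle.rateConstant_pos, fun d n e f xstar x₀ Ω _ P _ σ l T hT h =>
      h.expectedError_le hμ hT⟩, fun c => ⟨RandomShuffle.rateConstant μ L LH D G * (1 + c ^ 2),
    mul_pos RandomShuffle.rateConstant_pos (by positivity),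
    fun d n e f xstar x₀ Ω _ P _ σ l T hT h hc => (h.expectedError_le hμ hT).trans ?_⟩⟩⟩
  have hnT : (n : ℝ) ≤ T := by
    rw [hT]
    exact_mod_cast Nat.le_mul_of_pos_left n h.l_pos
  have hK : 0 ≤ RandomShuffle.rateConstant μ L LH D G * Real.log T ^ 3 :=
    mul_nonneg RandomShuffle.rateConstant_pos.le (pow_nonneg (Real.log_natCast_nonneg T) 3)
  exact (mul_le_mul_of_nonneg_left (RandomShuffle.sparsity_term_le h.n_pos hnT hc) hK).trans
    (le_of_eq (by ring))
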